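/- Let $A\in\mathbb{C}^{n\times n}$ be Hermitian positive semidefinite with spectral radius $\rho=\rho(A)$. The graph of $A$ has nodes $1,\dots,n$ and an edge between $i\neq j$ exactly when $a_{ij}\neq 0$; let $d(i,j)$ denote the length of a shortest path from $i$ to $j$ in this graph, with $d(i,j)=\infty$ if there is no path. For $f:[0,\infty)\to\mathbb{R}$ and an eigendecomposition $A=V\,\mathrm{diag}(\lambda_k)V^H$ put $f(A)=V\,\mathrm{diag}(f(\lambda_k))V^H$; this defines $A^\alpha$ and $\sqrt A$. Write $$\Gamma(z,s)=\int_s^\infty t^{z-1}e^{-t}\,dt,\qquad \gamma(z,s)=\int_0^s t^{z-1}e^{-t}\,dt,\qquad \operatorname{erfc}(z)=1-\frac1{\sqrt\pi}\int_{-z}^{z}e^{-t^2}\,dt .$$ Let $i,j$ be indices with $d=d(i,j)\ge 2$. If $d=\infty$, then $[A^\alpha]_{ij}=0$ for all $\alpha\in(0,1)$ and $[\sqrt A]_{ij}=0$. If $d<\infty$, the following hold. 1. For every $\alpha\in(0,1)$, $$|[A^\alpha]_{ij}|\le\frac{\alpha}{\Gamma(1-\alpha)}\left(\frac{10\,e^{d}\rho^\alpha}{4^\alpha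 d^{d}}\,\gamma\!\left(d-\alpha-1,\tfrac d2\right)+10\left(\frac{5\rho}{4d^2}\right)^{\alpha}\left(\Gamma\!\left(\alpha,\tfrac45\right)-\Gamma\!\left(\alpha,\tfrac{2d}5\right)\right)+\frac{\rho^\alpha}{\alpha\, d^{2\alpha}}\right).$$ 2. For $\alpha=\tfrac12$, $$|[\sqrt A]_{ij}|\le\frac1{2\sqrt\pi}\left(\frac{10\,e^{d}\sqrt{\pi\rho}}{2d^{d}}\,\gamma\!\left(d-\tfrac32,\tfrac d2\right)+\frac{5\sqrt{5\pi\rho}}{d}\left(\operatorname{erfc}\!\left(\tfrac2{\sqrt5}\right)-\operatorname{erfc}\!\left(\sqrt{\tfrac{2d}5}\right)\right)+\frac{2\sqrt\rho}{d}\right).$$ 3. For every $\alpha\in(0,1)$ there is a constant $C>0$ depending only on $\alpha$ (not on $n$, $A$, $i$, $j$) such that $|[A^\alpha]_{ij}|\le C\,\rho^\alpha\, d^{-2\alpha}$. -/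

import Mathlib

open scoped ComplexOrder

/-- The graph of a Hermitian matrix: its nodes are the indices, and two distinct nodes `i`, `j` are
joined by an edge exactly when the entry `A i j` is nonzero. -/
def hermitianGraph {n : ℕ} (A : Matrix (Fin n) (Fin n) ℂ) (hA : A.IsHermitian) :
    SimpleGraph (Fin n) where
  Adj i j := i ≠ j ∧ A i j ≠ 0
  symm := ⟨fun i j h => ⟨h.1.symm, fun h0 => h.2 (by rw [← hA.apply i j, h0, star_zero])⟩⟩
  loopless := ⟨fun _ h => h.1 rfl⟩

/-- The upper incomplete gamma function `Γ(z, s) = ∫_s^∞ t^(z-1) e^(-t) dt`. -/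
noncomputable def upperIncompleteGamma (z s : ℝ) : ℝ :=
  ∫ t in Set.Ioi s, t ^ (z - 1) * Real.exp (-t)

/-- The lower incomplete gamma function `γ(z, s) = ∫_0^s t^(z-1) e^(-t) dt`. -/
noncomputable def lowerIncompleteGamma (z s : ℝ) : ℝ :=
  ∫ t in (0 : ℝ)..s, t ^ (z - 1) * Real.exp (-t)

/-- The error function `erf z = π^(-1/2) ∫_{-z}^z e^(-t²) dt`. -/
noncomputable def realErf (z : ℝ) : ℝ :=
  1 / √Real.pi * ∫ t in (-z)..z, Real.exp (-t ^ 2)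

/-- The complementary error function `erfc z = 1 - erf z`. -/
noncomputable def realErfc (z : ℝ) : ℝ := 1 - realErf z

/-- The spectral radius of a complex matrix, as a real number. -/
noncomputable def matrixSpectralRadius {n : ℕ} (A : Matrix (Fin n) (Fin n) ℂ) : ℝ :=
  (spectralRadius ℂ A).toReal

/-- The fractional power `A ^ α` of a Hermitian matrix: the function `x ↦ x ^ α` is applied to the
eigenvalues in an eigendecomposition of `A`. -/
noncomputable def matrixPower {n : ℕ} (A : Matrix (Fin n) (Fin n) ℂ) (α : ℝ) :
    Matrix (Fin n) (Fin n) ℂ :=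
  cfc (fun x : ℝ => x ^ α) A

/-- The square root of a Hermitian positive semidefinite matrix, again through eigenvalues. -/
noncomputable def matrixSqrt {n : ℕ} (A : Matrix (Fin n) (Fin n) ℂ) :
    Matrix (Fin n) (Fin n) ℂ :=
  cfc Real.sqrt A

/-! Diagonalising `A` gives `f(A) i j = ∑ k, w k * f (λ k)`, where the weights have total mass at
most one. Since `p(A) i j = 0` for polynomials of degree below `d`, this functional annihilates such
`p`. With `λ = (ρ / 4) * 2 (1 + y)` the nodes `y` lie in `[-1, 1]`.

The core is a bound on the functional at `exp (-2x (1 + y))`. Multiplication by `y` averages `T (r +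
1)` and `T (r - 1)`, so powers of `y` act on Chebyshev polynomials like a simple random walk, and
only indices `|r| ≥ d` contribute. A Chernoff argument with free parameter `s` gives `2 exp (2x
(cosh s - 1) - s d)` (`norm_sum_exp_le`). Taking `s = log (d / x)` for `x ≤ d / 2` and `s = d /
(2x)` for `x ≥ d / 2` yields a superexponential and a Gaussian regime.

Finally `Γ(1 - α) / α * μ ^ α = ∫ (1 - exp (-tμ)) t ^ (-α - 1) dt` over `(0, ∞)`, and `∑ w = 0`
removes the constant. Splitting at `d / 2` and `d² / 4` produces the three terms of the explicit
bound. A cruder estimate linear in `x / d²`, split at `d²`, gives the power law. -/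

/-! ### Chernoff bound for functionals that annihilate low degrees -/

open Polynomial in
/-- A functional `∑ w k * p (y k)` of total mass at most one on `[-1, 1]` that vanishes on polynomials
of degree less than `d` is small on `X ^ m * T k`. -/
lemma norm_sum_pow_mul_chebyshev_le {ι : Type*} [Fintype ι] {w : ι → ℂ} {y : ι → ℝ} {d : ℕ}
    (hw : ∑ k, ‖w k‖ ≤ 1) (hy : ∀ k, |y k| ≤ 1)
    (hd : ∀ p : ℝ[X], p.natDegree < d → ∑ k, w k * ((p.eval (y k) : ℝ) : ℂ) = 0) (s : ℝ) (m : ℕ) :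
    ∀ r : ℤ, ‖∑ k, w k * ((y k ^ m * (Chebyshev.T ℝ r).eval (y k) : ℝ) : ℂ)‖ ≤
      Real.cosh s ^ m * (Real.cosh (s * r) / Real.cosh (s * d)) := by
  induction m with
  | zero =>
    intro r
    simp only [pow_zero, one_mul]
    -- Indices below `d` are annihilated; for the others `|T r| ≤ 1` on `[-1, 1]` and the quotient
    -- of `cosh` is at least one.
    by_cases hr : r.natAbs < d
    · rw [hd _ (by rwa [Chebyshev.natDegree_T]), norm_zero]
      positivity
    · have h1 : ‖∑ k, w k * (((Chebyshev.T ℝ r).eval (y k) : ℝ) : ℂ)‖ ≤ 1 := by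
        refine (norm_sum_le _ _).trans ((Finset.sum_le_sum fun k _ => ?_).trans hw)
        rw [norm_mul, Complex.norm_real, Real.norm_eq_abs]
        exact mul_le_of_le_one_right (norm_nonneg _) (Chebyshev.abs_eval_T_real_le_one r (hy k))
      refine h1.trans ?_
      rw [one_le_div (Real.cosh_pos _), Real.cosh_le_cosh, abs_mul, abs_mul]
      refine mul_le_mul_of_nonneg_left ?_ (abs_nonneg s)
      rw [← Int.cast_abs, Nat.abs_cast, Int.abs_eq_natAbs]
      push Not at hr
      exact_mod_cast hr
  | succ m ih =>
    intro r
    have key : ∑ k, w k * ((y k ^ (m + 1) * (Chebyshev.T ℝ r).eval (y k) : ℝ) : ℂ) =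
        (∑ k, w k * ((y k ^ m * (Chebyshev.T ℝ (r + 1)).eval (y k) : ℝ) : ℂ) +
          ∑ k, w k * ((y k ^ m * (Chebyshev.T ℝ (r - 1)).eval (y k) : ℝ) : ℂ)) / 2 := by
      rw [← Finset.sum_add_distrib, Finset.sum_div]
      refine Finset.sum_congr rfl fun k _ => ?_
      rw [Chebyshev.T_add_one]
      simp only [eval_sub, eval_mul, eval_X, eval_ofNat]
      push_cast
      ring
    rw [key, norm_div, Complex.norm_ofNat]
    have h := (norm_add_le _ _).trans (add_le_add (ih (r + 1)) (ih (r - 1)))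
    -- No loss here: `r ↦ cosh (s r)` is an eigenfunction of the averaging, with eigenvalue `cosh
    -- s`.
    refine (div_le_div_of_nonneg_right h zero_le_two).trans_eq ?_
    push_cast
    rw [mul_add, mul_sub, mul_one, Real.cosh_add, Real.cosh_sub]
    ring

-- Expand `exp (-2xy)` in powers of `y` and apply the preceding bound with `r = 0` termwise; the
-- series sums to `exp (2x cosh s) / cosh (s d)`.
open Polynomial in
lemma norm_sum_exp_le {ι : Type*} [Fintype ι] {w : ι → ℂ} {y : ι → ℝ} {d : ℕ}
    (hw : ∑ k, ‖w k‖ ≤ 1) (hy : ∀ k, |y k| ≤ 1)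
    (hd : ∀ p : ℝ[X], p.natDegree < d → ∑ k, w k * ((p.eval (y k) : ℝ) : ℂ) = 0)
    (s : ℝ) {x : ℝ} (hx : 0 ≤ x) :
    ‖∑ k, w k * (Real.exp (-(x * (2 * (1 + y k)))) : ℂ)‖ ≤
      2 * Real.exp (2 * x * (Real.cosh s - 1) - s * d) := by
  have hsum : HasSum (fun m : ℕ => ((-(2 * x)) ^ m / (m.factorial : ℝ) : ℝ) *
      ∑ k, w k * ((y k ^ m : ℝ) : ℂ)) (∑ k, w k * (Real.exp (-(2 * x) * y k) : ℂ)) := by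
    have h1 (k : ι) : HasSum (fun m : ℕ => w k * (((-(2 * x) * y k) ^ m / (m.factorial : ℝ) : ℝ) : ℂ))
        (w k * (Real.exp (-(2 * x) * y k) : ℂ)) := by
      have := NormedSpace.expSeries_div_hasSum_exp (-(2 * x) * y k)
      rw [← Real.exp_eq_exp_ℝ] at this
      exact (Complex.hasSum_ofReal.2 this).mul_left _
    refine (hasSum_sum fun k _ => h1 k).congr_fun fun m => ?_
    rw [Finset.mul_sum]
    refine Finset.sum_congr rfl fun k _ => ?_
    push_cast
    rw [mul_pow]
    ring
  have hbound : HasSum (fun m : ℕ => (2 * x * Real.cosh s) ^ m / (m.factorial : ℝ) *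
      (Real.cosh (s * d))⁻¹) (Real.exp (2 * x * Real.cosh s) * (Real.cosh (s * d))⁻¹) := by
    have := NormedSpace.expSeries_div_hasSum_exp (2 * x * Real.cosh s)
    rw [← Real.exp_eq_exp_ℝ] at this
    exact this.mul_right _
  have h2 : ‖∑ k, w k * (Real.exp (-(2 * x) * y k) : ℂ)‖ ≤
      Real.exp (2 * x * Real.cosh s) * (Real.cosh (s * d))⁻¹ := by
    rw [← hsum.tsum_eq]
    refine tsum_of_norm_bounded hbound fun m => ?_
    have h := norm_sum_pow_mul_chebyshev_le hw hy hd s m 0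
    simp only [Chebyshev.T_zero, eval_one, mul_one, Int.cast_zero, mul_zero, Real.cosh_zero,
      one_div] at h
    rw [norm_mul, Complex.norm_real, Real.norm_eq_abs, abs_div, abs_pow, abs_neg,
      abs_of_nonneg (by positivity : 0 ≤ 2 * x), Nat.abs_cast, mul_pow _ (Real.cosh s)]
    calc _ ≤ (2 * x) ^ m / (m.factorial : ℝ) * (Real.cosh s ^ m * (Real.cosh (s * d))⁻¹) := by
          gcongr
      _ = _ := by ring
  have h3 : (Real.cosh (s * d))⁻¹ ≤ 2 * Real.exp (-(s * d)) := by
    rw [inv_le_iff_one_le_mul₀ (Real.cosh_pos _), Real.cosh_eq]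
    have h4 : Real.exp (-(s * d)) * Real.exp (s * d) = 1 := by rw [← Real.exp_add]; simp
    nlinarith [sq_nonneg (Real.exp (-(s * d)))]
  have h5 : ∑ k, w k * (Real.exp (-(x * (2 * (1 + y k)))) : ℂ) =
      (Real.exp (-(2 * x)) : ℂ) * ∑ k, w k * (Real.exp (-(2 * x) * y k) : ℂ) := by
    rw [Finset.mul_sum]
    refine Finset.sum_congr rfl fun k _ => ?_
    rw [mul_left_comm (Complex.ofReal _), ← Complex.ofReal_mul, ← Real.exp_add]
    congr 3
    ring
  rw [h5, norm_mul, Complex.norm_real, Real.norm_eq_abs, Real.abs_exp]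
  calc _ ≤ Real.exp (-(2 * x)) * (Real.exp (2 * x * Real.cosh s) * (2 * Real.exp (-(s * d)))) := by
        gcongr
        exact h2.trans (by gcongr)
    _ = 2 * (Real.exp (-(2 * x)) * Real.exp (2 * x * Real.cosh s) * Real.exp (-(s * d))) := by ring
    _ = _ := by
        rw [← Real.exp_add, ← Real.exp_add]
        ring_nf

/-! ### Choosing the Chernoff parameter -/

/-- The odd Taylor terms cancel, leaving `r² / 2` and a remainder of order `r⁴ ≤ r²`. The slack up
to `3 / 5` is what produces the `5` in the Gaussian exponent. -/
lemma cosh_sub_one_le_of_abs_le_one {r : ℝ} (hr : |r| ≤ 1) : Real.cosh r - 1 ≤ 3 / 5 * r ^ 2 := by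
  have h1 := Real.exp_bound hr (n := 4) (by norm_num)
  have h2 := Real.exp_bound (x := -r) (by rwa [abs_neg]) (n := 4) (by norm_num)
  simp only [Finset.sum_range_succ, Finset.range_zero, Finset.sum_empty, abs_neg] at h1 h2
  norm_num [Nat.factorial] at h1 h2
  have h3 := (abs_le.1 h1).2
  have h4 := (abs_le.1 h2).2
  have h5 : |r| ^ 4 ≤ r ^ 2 := by
    rw [← sq_abs r]
    exact pow_le_pow_of_le_one (abs_nonneg r) hr (by norm_num)
  rw [Real.cosh_eq]
  have h6 : r ^ 4 ≤ r ^ 2 := by rwa [Even.pow_abs (by decide)] at h5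
  nlinarith

/-- Gaussian regime of the Chernoff bound. -/
lemma two_mul_exp_le_gaussian {d x : ℝ} (hd : 0 < d) (h : d ≤ 2 * x) :
    2 * Real.exp (2 * x * (Real.cosh (d / (2 * x)) - 1) - d / (2 * x) * d) ≤
      10 * Real.exp (-(d ^ 2 / (5 * x))) := by
  have hx : 0 < x := by linarith
  have hr : |d / (2 * x)| ≤ 1 := by
    rw [abs_of_pos (by positivity), div_le_one (by positivity)]
    exact h
  have h1 := mul_le_mul_of_nonneg_left (cosh_sub_one_le_of_abs_le_one hr)
    (by positivity : 0 ≤ 2 * x)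
  -- The choice `s = d / (2x)` minimises the quadratic approximation `x s² - s d`.
  have h2 : 2 * x * (3 / 5 * (d / (2 * x)) ^ 2) - d / (2 * x) * d = -(d ^ 2 / (5 * x)) := by
    field_simp
    ring
  have h3 : Real.exp (2 * x * (Real.cosh (d / (2 * x)) - 1) - d / (2 * x) * d) ≤
      Real.exp (-(d ^ 2 / (5 * x))) := Real.exp_le_exp.2 (by linarith)
  linarith [Real.exp_pos (-(d ^ 2 / (5 * x)))]

/-- Superexponential regime of the Chernoff bound. -/
lemma two_mul_exp_le_superexponential {d : ℕ} {x : ℝ} (hx : 0 < x) (h : 2 * x ≤ d) :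
    2 * Real.exp (2 * x * (Real.cosh (Real.log (d / x)) - 1) - Real.log (d / x) * d) ≤
      10 * (Real.exp (-x) / x * (Real.exp 1 * x / d) ^ d) := by
  have hd : (0 : ℝ) < d := by linarith
  have e1 : Real.exp (-(Real.log (d / x) * d)) = (x / d) ^ d := by
    rw [← neg_mul, ← Real.log_inv, inv_div, mul_comm, Real.exp_nat_mul,
      Real.exp_log (by positivity)]
  have e2 : 2 * x * (Real.cosh (Real.log (d / x)) - 1) - Real.log (d / x) * d =
      (-x + -x + x ^ 2 / d) + d + -(Real.log (d / x) * d) := by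
    rw [Real.cosh_log (by positivity)]
    field_simp
    ring
  have e3 : Real.exp (d : ℝ) = Real.exp 1 ^ d := by rw [← Real.exp_nat_mul, mul_one]
  -- One factor `exp (-x)` is kept; as `x² / d ≤ x / 2`, the other is at most `exp (-x / 2) ≤ 2 /
  -- x`, relaxed to `5 / x` so that the final constant is `10`.
  have e4 : Real.exp (-x + -x + x ^ 2 / d) ≤ 5 * (Real.exp (-x) / x) := by
    have h1 : x ^ 2 / d ≤ x / 2 := by
      rw [div_le_div_iff₀ hd two_pos]
      nlinarith
    have h2 : Real.exp (-x + x ^ 2 / d) ≤ 5 / x := by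
      have h3 : x / 2 ≤ Real.exp (x / 2) := by linarith [Real.add_one_le_exp (x / 2)]
      have h4 : Real.exp (-x + x ^ 2 / d) ≤ (Real.exp (x / 2))⁻¹ := by
        rw [← Real.exp_neg]
        exact Real.exp_le_exp.2 (by linarith)
      refine h4.trans ?_
      rw [inv_le_comm₀ (Real.exp_pos _) (by positivity), inv_div]
      linarith
    rw [add_assoc, Real.exp_add]
    calc _ ≤ Real.exp (-x) * (5 / x) := by gcongr
      _ = _ := by ring
  rw [e2, Real.exp_add, Real.exp_add, e1, e3, mul_div_assoc, mul_pow]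
  calc _ ≤ 2 * (5 * (Real.exp (-x) / x) * Real.exp 1 ^ d * (x / d) ^ d) := by gcongr
    _ = _ := by ring

/-- By `e u ≤ exp u` with `u = x / d`, all but two of the `d` factors multiply to at most `exp x`,
which cancels `exp (-x)`; the remaining two supply `x² / d²`. -/
lemma exp_neg_div_mul_pow_le {d : ℕ} (hd : 2 ≤ d) {x : ℝ} (hx : 0 < x) (hxd : x ≤ d) :
    Real.exp (-x) / x * (Real.exp 1 * x / d) ^ d ≤ Real.exp 2 * (x / (d : ℝ) ^ 2) := by
  obtain ⟨m, rfl⟩ := Nat.exists_eq_add_of_le' hd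
  have hd0 : (0 : ℝ) < ((m + 2 : ℕ) : ℝ) := by positivity
  set D : ℝ := ((m + 2 : ℕ) : ℝ) with hD
  have h1 : Real.exp 1 * x / D ≤ Real.exp (x / D) := by
    have := Real.add_one_le_exp (x / D - 1)
    rw [Real.exp_sub, sub_add_cancel, le_div_iff₀ (Real.exp_pos 1)] at this
    linarith [this, mul_div_assoc (Real.exp 1) x D, mul_comm (x / D) (Real.exp 1)]
  have h2 : (Real.exp 1 * x / D) ^ m ≤ Real.exp x := by
    refine (pow_le_pow_left₀ (by positivity) h1 m).trans ?_
    rw [← Real.exp_nat_mul, Real.exp_le_exp]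
    have : (m : ℝ) = D - 2 := by rw [hD]; push_cast; ring
    rw [this]
    have h3 : D * (x / D) = x := by field_simp
    have : 0 ≤ x / D := by positivity
    linarith
  calc _ = (Real.exp 1 * x / D) ^ m * (Real.exp (-x) / x * (Real.exp 1 * x / D) ^ 2) := by
        rw [pow_add]; ring
    _ ≤ Real.exp x * (Real.exp (-x) / x * (Real.exp 1 * x / D) ^ 2) := by gcongr
    _ = (Real.exp x * Real.exp (-x)) * (Real.exp 1 ^ 2 * (x / D ^ 2)) := by field_simp
    _ = _ := by
        rw [← Real.exp_add, ← Real.exp_nat_mul]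
        norm_num

lemma exp_neg_div_le {d x : ℝ} (hd : 0 < d) (hx : 0 < x) :
    Real.exp (-(d ^ 2 / (5 * x))) ≤ 5 * (x / d ^ 2) := by
  have h := Real.add_one_le_exp (d ^ 2 / (5 * x))
  rw [Real.exp_neg, inv_le_comm₀ (Real.exp_pos _) (by positivity)]
  have : (5 * (x / d ^ 2))⁻¹ = d ^ 2 / (5 * x) := by field_simp
  linarith

/-! ### Integral representation of fractional powers -/

section

open MeasureTheory Filter Topology Set

lemma integrableOn_one_sub_exp_mul_rpow {α : ℝ} (h0 : 0 < α) (h1 : α < 1) :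
    IntegrableOn (fun t : ℝ => (1 - Real.exp (-t)) * t ^ (-α - 1)) (Ioi 0) := by
  have hm : AEStronglyMeasurable (fun t : ℝ => (1 - Real.exp (-t)) * t ^ (-α - 1)) := by
    fun_prop
  rw [← Ioc_union_Ioi_eq_Ioi (zero_le_one (α := ℝ)), integrableOn_union]
  constructor
  · have hi : IntegrableOn (fun t : ℝ => t ^ (-α)) (Ioc 0 1) :=
      (intervalIntegrable_iff_integrableOn_Ioc_of_le zero_le_one).1
        (intervalIntegral.intervalIntegrable_rpow' (by linarith))
    refine hi.mono' hm.restrict ((ae_restrict_iff' measurableSet_Ioc).2 (ae_of_all _ fun t ht => ?_))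
    have e0 : Real.exp (-t) ≤ 1 := Real.exp_le_one_iff.2 (by linarith [ht.1])
    have e1 : 1 - Real.exp (-t) ≤ t := by linarith [Real.add_one_le_exp (-t)]
    have ht0 := ht.1
    rw [Real.norm_of_nonneg (mul_nonneg (by linarith) (by positivity))]
    calc _ ≤ t * t ^ (-α - 1) := by gcongr
      _ = _ := by rw [Real.rpow_sub_one ht.1.ne', mul_div_cancel₀ _ ht.1.ne']
  · have hi : IntegrableOn (fun t : ℝ => t ^ (-α - 1)) (Ioi 1) :=
      integrableOn_Ioi_rpow_of_lt (by linarith) one_pos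
    refine hi.mono' hm.restrict ((ae_restrict_iff' measurableSet_Ioi).2 (ae_of_all _ fun t ht => ?_))
    have ht0 : (0 : ℝ) < t := one_pos.trans ht
    have e0 : Real.exp (-t) ≤ 1 := Real.exp_le_one_iff.2 (by linarith)
    rw [Real.norm_of_nonneg (mul_nonneg (by linarith) (by positivity))]
    exact mul_le_of_le_one_left (by positivity) (by linarith [Real.exp_pos (-t)])

/-- Integration by parts against `-t ^ (-α) / α` leaves the Gamma integral; the boundary terms
vanish because `1 - exp (-t) ≤ t` near zero and `α > 0` at infinity. -/
lemma integral_one_sub_exp_mul_rpow {α : ℝ} (h0 : 0 < α) (h1 : α < 1) :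
    ∫ t in Ioi (0 : ℝ), (1 - Real.exp (-t)) * t ^ (-α - 1) = Real.Gamma (1 - α) / α := by
  have hG := Real.GammaIntegral_convergent (s := 1 - α) (by linarith)
  have heq : (fun t : ℝ => Real.exp (-t) * (-t ^ (-α) / α)) =
      fun t => (-1 / α) * (Real.exp (-t) * t ^ (1 - α - 1)) := by
    ext t
    rw [show 1 - α - 1 = -α by ring]
    ring
  have lim1 : Tendsto ((fun t : ℝ => 1 - Real.exp (-t)) * fun t => -t ^ (-α) / α)
      (𝓝[>] 0) (𝓝 0) := by
    refine squeeze_zero_norm' (a := fun t : ℝ => t ^ (1 - α) / α) ?_ ?_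
    · filter_upwards [self_mem_nhdsWithin] with t ht
      have ht0 : 0 < t := ht
      have e0 : Real.exp (-t) ≤ 1 := Real.exp_le_one_iff.2 (by linarith)
      have e1 : 1 - Real.exp (-t) ≤ t := by linarith [Real.add_one_le_exp (-t)]
      rw [Pi.mul_apply, norm_mul, Real.norm_of_nonneg (by linarith : 0 ≤ 1 - Real.exp (-t)), neg_div,
        norm_neg, Real.norm_of_nonneg (by positivity), ← mul_div_assoc, sub_eq_add_neg 1 α,
        Real.rpow_add ht0, Real.rpow_one]
      gcongr
    · have : Tendsto (fun t : ℝ => t ^ (1 - α) / α) (𝓝 0) (𝓝 ((0 : ℝ) ^ (1 - α) / α)) :=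
        ((Real.continuousAt_rpow_const 0 (1 - α) (Or.inr (by linarith))).tendsto).div_const α
      rw [Real.zero_rpow (by linarith), zero_div] at this
      exact this.mono_left nhdsWithin_le_nhds
  have lim2 : Tendsto ((fun t : ℝ => 1 - Real.exp (-t)) * fun t => -t ^ (-α) / α)
      atTop (𝓝 0) := by
    have a1 : Tendsto (fun t : ℝ => 1 - Real.exp (-t)) atTop (𝓝 (1 - 0)) :=
      tendsto_const_nhds.sub Real.tendsto_exp_neg_atTop_nhds_zero
    have a2 : Tendsto (fun t : ℝ => -t ^ (-α) / α) atTop (𝓝 (-0 / α)) :=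
      ((tendsto_rpow_neg_atTop h0).neg).div_const α
    have a3 := a1.mul a2
    simp only [neg_zero, zero_div, mul_zero] at a3
    exact a3
  have := integral_Ioi_mul_deriv_eq_deriv_mul (a := (0 : ℝ))
    (u := fun t : ℝ => 1 - Real.exp (-t)) (u' := fun t => Real.exp (-t))
    (v := fun t => -t ^ (-α) / α) (v' := fun t => t ^ (-α - 1)) (a' := 0) (b' := 0)
    (fun t _ => by simpa using ((hasDerivAt_neg t).exp.const_sub 1))
    (fun t ht => by
      have := ((Real.hasDerivAt_rpow_const (p := -α) (Or.inl (ne_of_gt ht))).neg).div_const α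
      refine this.congr_deriv ?_
      field_simp)
    (integrableOn_one_sub_exp_mul_rpow h0 h1)
    (by
      change IntegrableOn (fun t : ℝ => Real.exp (-t) * (-t ^ (-α) / α)) (Ioi 0)
      rw [heq]
      exact hG.const_mul _) lim1 lim2
  rw [this, heq, integral_const_mul, ← Real.Gamma_eq_integral (by linarith)]
  ring

lemma integrableOn_one_sub_exp_mul_mul_rpow {α μ : ℝ} (h0 : 0 < α) (h1 : α < 1) (hμ : 0 ≤ μ) :
    IntegrableOn (fun t : ℝ => (1 - Real.exp (-(t * μ))) * t ^ (-α - 1)) (Ioi 0) := by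
  rcases hμ.eq_or_lt with rfl | hμ
  · simp
  · have h := (integrableOn_Ioi_comp_mul_left_iff
      (fun t : ℝ => (1 - Real.exp (-t)) * t ^ (-α - 1)) 0 hμ).2
      (by rw [mul_zero]; exact integrableOn_one_sub_exp_mul_rpow h0 h1)
    refine IntegrableOn.congr_fun (h.const_mul ((μ ^ (-α - 1))⁻¹)) (fun t ht => ?_) measurableSet_Ioi
    have : μ ^ (-α - 1) ≠ 0 := (Real.rpow_pos_of_pos hμ _).ne'
    rw [Real.mul_rpow hμ.le (le_of_lt ht), mul_comm μ t]
    field_simp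

lemma integral_one_sub_exp_mul_mul_rpow {α μ : ℝ} (h0 : 0 < α) (h1 : α < 1) (hμ : 0 ≤ μ) :
    ∫ t in Ioi (0 : ℝ), (1 - Real.exp (-(t * μ))) * t ^ (-α - 1) =
      Real.Gamma (1 - α) / α * μ ^ α := by
  rcases hμ.eq_or_lt with rfl | hμ
  · simp [Real.zero_rpow h0.ne']
  · have h := integral_comp_mul_left_Ioi
      (fun t : ℝ => (1 - Real.exp (-t)) * t ^ (-α - 1)) 0 hμ
    rw [mul_zero, integral_one_sub_exp_mul_rpow h0 h1] at h
    have e : ∀ t ∈ Ioi (0 : ℝ), (1 - Real.exp (-(t * μ))) * t ^ (-α - 1) =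
        (μ ^ (-α - 1))⁻¹ * ((1 - Real.exp (-(μ * t))) * (μ * t) ^ (-α - 1)) := fun t ht => by
      have : μ ^ (-α - 1) ≠ 0 := (Real.rpow_pos_of_pos hμ _).ne'
      rw [Real.mul_rpow hμ.le (le_of_lt ht), mul_comm μ t]
      field_simp
    rw [setIntegral_congr_fun measurableSet_Ioi e, integral_const_mul, h, smul_eq_mul,
      Real.rpow_sub_one hμ.ne', Real.rpow_neg hμ.le]
    have : μ ^ α ≠ 0 := (Real.rpow_pos_of_pos hμ _).ne'
    field_simp

section

variable {ι : Type*} [Fintype ι] {w : ι → ℂ} {μ : ι → ℝ} {α : ℝ}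

/-- Since `∑ w = 0`, the constant in `1 - exp (-tμ)` drops out, so bounds on the exponential sums
apply directly. -/
lemma integrableOn_sum_exp_mul_rpow (h0 : 0 < α) (h1 : α < 1) (hμ : ∀ k, 0 ≤ μ k)
    (hw : ∑ k, w k = 0) :
    IntegrableOn (fun t : ℝ => (∑ k, w k * (Real.exp (-(t * μ k)) : ℂ)) * ((t ^ (-α - 1) : ℝ) : ℂ))
      (Ioi 0) ∧
    ∫ t in Ioi (0 : ℝ), (∑ k, w k * (Real.exp (-(t * μ k)) : ℂ)) * ((t ^ (-α - 1) : ℝ) : ℂ) =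
      -((Real.Gamma (1 - α) / α : ℝ) * ∑ k, w k * ((μ k ^ α : ℝ) : ℂ)) := by
  have hi (k : ι) : IntegrableOn (fun t : ℝ =>
      w k * (((1 - Real.exp (-(t * μ k))) * t ^ (-α - 1) : ℝ) : ℂ)) (Ioi 0) :=
    ((integrableOn_one_sub_exp_mul_mul_rpow h0 h1 (hμ k)).ofReal).const_mul _
  have e : (fun t : ℝ => (∑ k, w k * (Real.exp (-(t * μ k)) : ℂ)) * ((t ^ (-α - 1) : ℝ) : ℂ)) =
      fun t => -∑ k, w k * (((1 - Real.exp (-(t * μ k))) * t ^ (-α - 1) : ℝ) : ℂ) := by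
    ext t
    have : ∑ k, w k * (((1 - Real.exp (-(t * μ k))) * t ^ (-α - 1) : ℝ) : ℂ) =
        (∑ k, w k - ∑ k, w k * (Real.exp (-(t * μ k)) : ℂ)) * ((t ^ (-α - 1) : ℝ) : ℂ) := by
      rw [← Finset.sum_sub_distrib, Finset.sum_mul]
      refine Finset.sum_congr rfl fun k _ => ?_
      push_cast
      ring
    rw [this, hw]
    ring
  rw [e]
  refine ⟨(integrable_finsetSum _ fun k _ => hi k).neg, ?_⟩
  rw [integral_neg, integral_finsetSum _ fun k _ => hi k, Finset.mul_sum]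
  congr 1
  refine Finset.sum_congr rfl fun k _ => ?_
  rw [integral_const_mul, integral_complex_ofReal, integral_one_sub_exp_mul_mul_rpow h0 h1 (hμ k)]
  push_cast
  ring

/-- Splitting the integral representation of the fractional power at two points. -/
lemma gamma_div_mul_norm_sum_rpow_le (h0 : 0 < α) (h1 : α < 1) (hμ : ∀ k, 0 ≤ μ k)
    (hw : ∑ k, w k = 0) (hw1 : ∑ k, ‖w k‖ ≤ 1) {a b : ℝ} (ha : 0 < a) (hab : a ≤ b)
    {f g : ℝ → ℝ} (hf : IntervalIntegrable f volume 0 a) (hg : IntervalIntegrable g volume a b)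
    (hfb : ∀ t, 0 < t → t ≤ a →
      ‖∑ k, w k * (Real.exp (-(t * μ k)) : ℂ)‖ * t ^ (-α - 1) ≤ f t)
    (hgb : ∀ t, a < t → t ≤ b →
      ‖∑ k, w k * (Real.exp (-(t * μ k)) : ℂ)‖ * t ^ (-α - 1) ≤ g t) :
    Real.Gamma (1 - α) / α * ‖∑ k, w k * ((μ k ^ α : ℝ) : ℂ)‖ ≤
      (∫ t in (0 : ℝ)..a, f t) + (∫ t in a..b, g t) + b ^ (-α) / α := by
  obtain ⟨hi, he⟩ := integrableOn_sum_exp_mul_rpow h0 h1 hμ hw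
  have hb : 0 < b := ha.trans_le hab
  have hΓ : 0 < Real.Gamma (1 - α) := Real.Gamma_pos_of_pos (by linarith)
  have e1 : Real.Gamma (1 - α) / α * ‖∑ k, w k * ((μ k ^ α : ℝ) : ℂ)‖ =
      ‖∫ t in Ioi (0 : ℝ), (∑ k, w k * (Real.exp (-(t * μ k)) : ℂ)) *
        ((t ^ (-α - 1) : ℝ) : ℂ)‖ := by
    rw [he, norm_neg, norm_mul, Complex.norm_real, Real.norm_of_nonneg (by positivity)]
  set F : ℝ → ℝ := fun t => ‖(∑ k, w k * (Real.exp (-(t * μ k)) : ℂ)) * ((t ^ (-α - 1) : ℝ) : ℂ)‖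
    with hF
  have hFi : IntegrableOn F (Ioi 0) := hi.norm
  have hFe : ∀ t, 0 < t → F t = ‖∑ k, w k * (Real.exp (-(t * μ k)) : ℂ)‖ * t ^ (-α - 1) :=
    fun t ht => by
      simp only [hF]
      rw [norm_mul, Complex.norm_real, Real.norm_of_nonneg (by positivity)]
  rw [e1]
  refine (norm_integral_le_integral_norm _).trans ?_
  change ∫ t in Ioi 0, F t ≤ _
  have i1 : IntegrableOn F (Ioc 0 a) := hFi.mono_set Ioc_subset_Ioi_self
  have i2 : IntegrableOn F (Ioc a b) := hFi.mono_set fun t ht => ha.trans ht.1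
  have i3 : IntegrableOn F (Ioi b) := hFi.mono_set fun t ht => hb.trans ht
  have i23 : IntegrableOn F (Ioi a) := hFi.mono_set fun t ht => ha.trans ht
  rw [← Ioc_union_Ioi_eq_Ioi ha.le, setIntegral_union (Ioc_disjoint_Ioi le_rfl) measurableSet_Ioi
    i1 i23, ← Ioc_union_Ioi_eq_Ioi hab, setIntegral_union (Ioc_disjoint_Ioi le_rfl)
    measurableSet_Ioi i2 i3, ← add_assoc]
  refine add_le_add (add_le_add ?_ ?_) ?_
  · rw [intervalIntegral.integral_of_le ha.le]
    refine setIntegral_mono_on i1 ((intervalIntegrable_iff_integrableOn_Ioc_of_le ha.le).1 hf)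
      measurableSet_Ioc fun t ht => ?_
    rw [hFe t ht.1]
    exact hfb t ht.1 ht.2
  · rw [intervalIntegral.integral_of_le hab]
    refine setIntegral_mono_on i2 ((intervalIntegrable_iff_integrableOn_Ioc_of_le hab).1 hg)
      measurableSet_Ioc fun t ht => ?_
    rw [hFe t (ha.trans ht.1)]
    exact hgb t ht.1 ht.2
  -- Beyond `b` no cancellation is used: the exponential sum is bounded by the total mass.
  · have e2 : ∫ t in Ioi b, t ^ (-α - 1) = b ^ (-α) / α := by
      rw [integral_Ioi_rpow_of_lt (by linarith) hb, sub_add_cancel, div_neg, neg_div, neg_neg]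
    rw [← e2]
    refine setIntegral_mono_on i3 (integrableOn_Ioi_rpow_of_lt (by linarith) hb)
      measurableSet_Ioi fun t ht => ?_
    have ht0 : 0 < t := hb.trans ht
    rw [hFe t ht0]
    refine mul_le_of_le_one_left (by positivity) ((norm_sum_le _ _).trans
      ((Finset.sum_le_sum fun k _ => ?_).trans hw1))
    rw [norm_mul, Complex.norm_real, Real.norm_eq_abs, Real.abs_exp]
    refine mul_le_of_le_one_right (norm_nonneg _) (Real.exp_le_one_iff.2 ?_)
    have := mul_nonneg ht0.le (hμ k)
    linarith

end

end

/-! ### Bounds for the functional on fractional powers -/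

open Polynomial in
lemma sum_eq_zero_of_forall_natDegree_lt {ι : Type*} [Fintype ι] {w : ι → ℂ} {y : ι → ℝ} {d : ℕ}
    (hd : ∀ p : ℝ[X], p.natDegree < d → ∑ k, w k * ((p.eval (y k) : ℝ) : ℂ) = 0) (h : 0 < d) :
    ∑ k, w k = 0 := by
  simpa using hd 1 (by simpa using h)

lemma two_mul_one_add_nonneg {y : ℝ} (hy : |y| ≤ 1) : 0 ≤ 2 * (1 + y) := by
  linarith [(abs_le.1 hy).1]

section

open Polynomial

variable {ι : Type*} [Fintype ι] {w : ι → ℂ} {y : ι → ℝ} {d : ℕ}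
  (hw : ∑ k, ‖w k‖ ≤ 1) (hy : ∀ k, |y k| ≤ 1)
  (hd : ∀ p : ℝ[X], p.natDegree < d → ∑ k, w k * ((p.eval (y k) : ℝ) : ℂ) = 0)

include hw hy hd

lemma norm_sum_exp_le_superexponential {x : ℝ} (hx : 0 < x) (h : x ≤ d / 2) :
    ‖∑ k, w k * (Real.exp (-(x * (2 * (1 + y k)))) : ℂ)‖ ≤
      10 * (Real.exp (-x) / x * (Real.exp 1 * x / d) ^ d) :=
  (norm_sum_exp_le hw hy hd (Real.log (d / x)) hx.le).trans
    (two_mul_exp_le_superexponential hx (by linarith))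

lemma norm_sum_exp_le_gaussian {x : ℝ} (hd0 : 0 < d) (h : (d : ℝ) / 2 ≤ x) :
    ‖∑ k, w k * (Real.exp (-(x * (2 * (1 + y k)))) : ℂ)‖ ≤
      10 * Real.exp (-((d : ℝ) ^ 2 / (5 * x))) := by
  have h0 : (0 : ℝ) < d := by exact_mod_cast hd0
  exact (norm_sum_exp_le hw hy hd (d / (2 * x)) (by linarith)).trans
    (two_mul_exp_le_gaussian h0 (by linarith))

/-- Both regimes are dominated by multiples of `x / d²`, namely `10 e²` and `50`. Linearity in `x`
makes the integral against `t ^ (-α - 1)` converge at zero. -/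
lemma norm_sum_exp_le_linear {x : ℝ} (hd2 : 2 ≤ d) (hx : 0 < x) :
    ‖∑ k, w k * (Real.exp (-(x * (2 * (1 + y k)))) : ℂ)‖ ≤ 100 * (x / (d : ℝ) ^ 2) := by
  have h0 : (0 : ℝ) < d := by positivity
  have hp : 0 ≤ x / (d : ℝ) ^ 2 := by positivity
  rcases le_total x (d / 2) with h | h
  · refine (norm_sum_exp_le_superexponential hw hy hd hx h).trans ?_
    have h1 := exp_neg_div_mul_pow_le hd2 hx (by linarith)
    have h2 : Real.exp 2 ≤ 10 := by
      have : Real.exp 2 = Real.exp 1 ^ 2 := by rw [← Real.exp_nat_mul]; norm_num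
      rw [this]
      nlinarith [Real.exp_one_lt_d9, Real.exp_pos 1]
    nlinarith [mul_le_mul_of_nonneg_right h2 hp]
  · refine (norm_sum_exp_le_gaussian hw hy hd (by omega) h).trans ?_
    have h1 := exp_neg_div_le h0 hx
    linarith

variable {α : ℝ} (h0 : 0 < α) (h1 : α < 1)

include h0 h1

lemma norm_sum_rpow_le_power_law (hd2 : 2 ≤ d) :
    Real.Gamma (1 - α) / α * ‖∑ k, w k * (((2 * (1 + y k)) ^ α : ℝ) : ℂ)‖ ≤
      (100 / (1 - α) + 1 / α) * ((d : ℝ) ^ 2) ^ (-α) := by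
  have hdp : (0 : ℝ) < (d : ℝ) ^ 2 := by positivity
  have hμ : ∀ k, 0 ≤ 2 * (1 + y k) := fun k => two_mul_one_add_nonneg (hy k)
  have hi : IntervalIntegrable (fun t : ℝ => 100 / (d : ℝ) ^ 2 * t ^ (-α)) MeasureTheory.volume 0
      ((d : ℝ) ^ 2) := (intervalIntegral.intervalIntegrable_rpow' (by linarith)).const_mul _
  -- Both split points are `d²`, so the middle interval is empty.
  refine (gamma_div_mul_norm_sum_rpow_le h0 h1 hμ
    (sum_eq_zero_of_forall_natDegree_lt hd (by omega)) hw hdp le_rfl hi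
    (g := fun _ => 0) (by simp) (fun t ht htd => ?_)
    fun t ht htd => absurd ht (not_lt.2 htd)).trans_eq ?_
  · refine (mul_le_mul_of_nonneg_right (norm_sum_exp_le_linear hw hy hd hd2 ht)
      (by positivity)).trans_eq ?_
    rw [Real.rpow_sub_one ht.ne']
    field_simp
  · rw [intervalIntegral.integral_const_mul, integral_rpow (Or.inl (by linarith)),
      intervalIntegral.integral_same, Real.zero_rpow (by linarith), Real.rpow_add hdp,
      Real.rpow_one]
    have : 1 - α ≠ 0 := by linarith
    have : -α + 1 ≠ 0 := by linarith
    field_simp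
    ring

lemma norm_sum_rpow_le_incompleteGamma (hd2 : 2 ≤ d) :
    Real.Gamma (1 - α) / α * ‖∑ k, w k * (((2 * (1 + y k)) ^ α : ℝ) : ℂ)‖ ≤
      10 * Real.exp d / (d : ℝ) ^ d * lowerIncompleteGamma ((d : ℝ) - α - 1) ((d : ℝ) / 2) +
      10 * ((d : ℝ) ^ 2 / 5) ^ (-α) *
        (upperIncompleteGamma α (4 / 5) - upperIncompleteGamma α (2 * (d : ℝ) / 5)) +
      ((d : ℝ) ^ 2 / 4) ^ (-α) / α := by
  have hd2' : (2 : ℝ) ≤ d := by exact_mod_cast hd2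
  have hdp : (0 : ℝ) < d := by linarith
  have hμ : ∀ k, 0 ≤ 2 * (1 + y k) := fun k => two_mul_one_add_nonneg (hy k)
  -- The split points are in order exactly because `d ≥ 2`.
  have hle : (d : ℝ) / 2 ≤ (d : ℝ) ^ 2 / 4 := by nlinarith
  have hpos : ∀ t ∈ Set.uIcc ((d : ℝ) / 2) ((d : ℝ) ^ 2 / 4), 0 < t := fun t ht => by
    rw [Set.uIcc_of_le hle] at ht
    linarith [ht.1]
  -- Integrability at zero needs `d - α - 2 > -1`, which follows from `d ≥ 2` and `α < 1`.
  have hi : IntervalIntegrable (fun t : ℝ => 10 * Real.exp d / (d : ℝ) ^ d *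
      (t ^ ((d : ℝ) - α - 1 - 1) * Real.exp (-t))) MeasureTheory.volume 0 ((d : ℝ) / 2) :=
    ((intervalIntegral.intervalIntegrable_rpow' (by linarith)).mul_continuousOn
      (by fun_prop)).const_mul _
  have hi2 : IntervalIntegrable (fun t : ℝ => 10 * (Real.exp (-((d : ℝ) ^ 2 / (5 * t))) *
      t ^ (-α - 1))) MeasureTheory.volume ((d : ℝ) / 2) ((d : ℝ) ^ 2 / 4) := by
    refine ContinuousOn.intervalIntegrable fun t ht => ContinuousAt.continuousWithinAt ?_
    have := hpos t ht
    have h5 : 5 * t ≠ 0 := by positivity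
    refine continuousAt_const.mul (ContinuousAt.mul ?_
      (Real.continuousAt_rpow_const _ _ (Or.inl this.ne')))
    exact ((continuousAt_const.div (by fun_prop) h5).neg).rexp
  refine (gamma_div_mul_norm_sum_rpow_le h0 h1 hμ
    (sum_eq_zero_of_forall_natDegree_lt hd (by omega)) hw (by linarith : 0 < (d : ℝ) / 2) hle hi hi2
    (fun t ht htd => ?_) fun t ht htd => ?_).trans_eq ?_
  · refine (mul_le_mul_of_nonneg_right (norm_sum_exp_le_superexponential hw hy hd ht htd)
      (by positivity)).trans_eq ?_
    have e1 : Real.exp (d : ℝ) = Real.exp 1 ^ d := by rw [← Real.exp_nat_mul, mul_one]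
    have e2 : t ^ ((d : ℝ) - α - 1 - 1) = t ^ d * t ^ (-α - 1) / t := by
      rw [show (d : ℝ) - α - 1 - 1 = d + (-α - 1) - 1 by ring, Real.rpow_sub_one ht.ne',
        Real.rpow_add ht, Real.rpow_natCast]
    rw [e1, e2, div_pow, mul_pow]
    field_simp
  · refine (mul_le_mul_of_nonneg_right (norm_sum_exp_le_gaussian hw hy hd (by omega) ht.le)
      (Real.rpow_nonneg (by linarith) _)).trans_eq ?_
    ring
  · have e3 : upperIncompleteGamma α (4 / 5) - upperIncompleteGamma α (2 * (d : ℝ) / 5) =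
        ∫ t in (4 / 5 : ℝ)..(2 * d / 5), t ^ (α - 1) * Real.exp (-t) := by
      have hG : MeasureTheory.IntegrableOn (fun t : ℝ => t ^ (α - 1) * Real.exp (-t))
          (Set.Ioi 0) :=
        (Real.GammaIntegral_convergent h0).congr_fun (fun t _ => mul_comm _ _) measurableSet_Ioi
      unfold upperIncompleteGamma
      exact (intervalIntegral.integral_Ioi_sub_Ioi (hG.mono_set (Set.Ioi_subset_Ioi (by norm_num)))
        (by linarith))
    -- Substituting `u = d² / (5t)` reverses orientation and sends `d / 2` to `2d / 5` and `d² / 4`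
    -- to `4 / 5`.
    have e4 : ∫ t in ((d : ℝ) / 2)..((d : ℝ) ^ 2 / 4),
        10 * (Real.exp (-((d : ℝ) ^ 2 / (5 * t))) * t ^ (-α - 1)) =
        10 * ((d : ℝ) ^ 2 / 5) ^ (-α) *
          ∫ t in (4 / 5 : ℝ)..(2 * d / 5), t ^ (α - 1) * Real.exp (-t) := by
      have hs := intervalIntegral.integral_comp_mul_deriv' (a := (d : ℝ) / 2)
        (b := (d : ℝ) ^ 2 / 4) (f := fun t => (d : ℝ) ^ 2 / 5 * t⁻¹)
        (f' := fun t => (d : ℝ) ^ 2 / 5 * (-(t ^ 2)⁻¹))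
        (g := fun t => t ^ (α - 1) * Real.exp (-t))
        (fun t ht => (hasDerivAt_inv (hpos t ht).ne').const_mul _)
        (fun t ht => ContinuousAt.continuousWithinAt
          (continuousAt_const.mul ((continuousAt_id.pow 2).inv₀ (pow_pos (hpos t ht) 2).ne').neg))
        (by
          rintro _ ⟨t, ht, rfl⟩
          have := hpos t ht
          refine ContinuousAt.continuousWithinAt (ContinuousAt.mul
            (Real.continuousAt_rpow_const _ _ (Or.inl (by positivity))) (by fun_prop)))
      have l1 : (d : ℝ) ^ 2 / 5 * ((d : ℝ) / 2)⁻¹ = 2 * d / 5 := by field_simp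
      have l2 : (d : ℝ) ^ 2 / 5 * ((d : ℝ) ^ 2 / 4)⁻¹ = 4 / 5 := by field_simp
      rw [l1, l2] at hs
      rw [intervalIntegral.integral_symm (2 * (d : ℝ) / 5), ← hs,
        ← intervalIntegral.integral_neg, ← intervalIntegral.integral_const_mul]
      refine intervalIntegral.integral_congr fun t ht => ?_
      have ht0 := hpos t ht
      have hc : (0 : ℝ) < (d : ℝ) ^ 2 / 5 := by positivity
      have e5 : (d : ℝ) ^ 2 / 5 * t⁻¹ = (d : ℝ) ^ 2 / (5 * t) := by field_simp
      simp only [Function.comp_apply]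
      rw [Real.mul_rpow hc.le (by positivity), e5, Real.inv_rpow ht0.le, Real.rpow_sub_one hc.ne',
        Real.rpow_sub_one ht0.ne', Real.rpow_sub_one ht0.ne', Real.rpow_neg hc.le,
        Real.rpow_neg ht0.le]
      have : ((d : ℝ) ^ 2 / 5) ^ α ≠ 0 := (Real.rpow_pos_of_pos hc _).ne'
      have : t ^ α ≠ 0 := (Real.rpow_pos_of_pos ht0 _).ne'
      field_simp
    rw [e3, e4, intervalIntegral.integral_const_mul, lowerIncompleteGamma]

end

/-! ### Matrix entries, spectrum and graph distance -/

open Matrix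

/-- The weights are products of entries from two rows of a unitary matrix; the mass bound is the
arithmetic-geometric mean inequality for unit rows. -/
lemma Matrix.IsHermitian.exists_cfc_apply_eq_sum {n : ℕ} {A : Matrix (Fin n) (Fin n) ℂ}
    (hA : A.IsHermitian) (i j : Fin n) :
    ∃ w : Fin n → ℂ, ∑ k, ‖w k‖ ≤ 1 ∧
      ∀ f : ℝ → ℝ, cfc f A i j = ∑ k, w k * (f (hA.eigenvalues k) : ℂ) := by
  set U : Matrix (Fin n) (Fin n) ℂ := (hA.eigenvectorUnitary : Matrix (Fin n) (Fin n) ℂ) with hU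
  have hUU : U * star U = 1 := Unitary.coe_mul_star_self hA.eigenvectorUnitary
  have hrow (i : Fin n) : ∑ k, ‖U i k‖ ^ 2 = 1 := by
    have h := congrFun (congrFun hUU i) i
    rw [Matrix.mul_apply, Matrix.one_apply_eq] at h
    have h' : ((∑ k, ‖U i k‖ ^ 2 : ℝ) : ℂ) = 1 := by
      rw [← h]
      push_cast
      refine Finset.sum_congr rfl fun k _ => ?_
      rw [Matrix.star_apply, Complex.star_def, Complex.mul_conj, Complex.normSq_eq_norm_sq]
      push_cast
      rfl
    exact_mod_cast h'
  refine ⟨fun k => U i k * star (U j k), ?_, fun f => ?_⟩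
  · calc ∑ k, ‖U i k * star (U j k)‖ ≤ ∑ k, (‖U i k‖ ^ 2 + ‖U j k‖ ^ 2) / 2 := by
          refine Finset.sum_le_sum fun k _ => ?_
          rw [norm_mul, norm_star]
          nlinarith [sq_nonneg (‖U i k‖ - ‖U j k‖)]
      _ = 1 := by
          rw [← Finset.sum_div, Finset.sum_add_distrib, hrow, hrow]
          norm_num
  · rw [hA.cfc_eq, Matrix.IsHermitian.cfc, Unitary.conjStarAlgAut_apply, Matrix.mul_apply]
    refine Finset.sum_congr rfl fun k _ => ?_
    rw [Matrix.mul_diagonal]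
    change U i k * (f (hA.eigenvalues k) : ℂ) * star (U j k) = U i k * star (U j k) * _
    ring

lemma eigenvalues_le_matrixSpectralRadius {n : ℕ} {A : Matrix (Fin n) (Fin n) ℂ}
    (hA : A.PosSemidef) (k : Fin n) :
    hA.isHermitian.eigenvalues k ≤ matrixSpectralRadius A := by
  have hmem : ((hA.isHermitian.eigenvalues k : ℝ) : ℂ) ∈ spectrum ℂ A :=
    spectrum.algebraMap_mem ℂ (hA.isHermitian.eigenvalues_mem_spectrum_real k)
  -- Finiteness matters because `toReal` sends `⊤` to zero; the local norm serves only to bound the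
  -- spectral radius.
  have hfin : spectralRadius ℂ A ≠ ⊤ := by
    let _ : NormedRing (Matrix (Fin n) (Fin n) ℂ) := Matrix.linftyOpNormedRing
    let _ : NormedAlgebra ℂ (Matrix (Fin n) (Fin n) ℂ) := Matrix.linftyOpNormedAlgebra
    have : Nonempty (Fin n) := ⟨k⟩
    have : NormOneClass (Matrix (Fin n) (Fin n) ℂ) := Matrix.linfty_opNormOneClass
    exact ne_top_of_le_ne_top ENNReal.coe_ne_top (spectrum.spectralRadius_le_nnnorm (𝕜 := ℂ) A)
  have h1 : ((‖((hA.isHermitian.eigenvalues k : ℝ) : ℂ)‖₊ : NNReal) : ENNReal) ≤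
      spectralRadius ℂ A :=
    le_iSup₂ (α := ENNReal) (f := fun z (_ : z ∈ spectrum ℂ A) => ((‖z‖₊ : NNReal) : ENNReal)) _ hmem
  have h2 := ENNReal.toReal_mono hfin h1
  rw [ENNReal.coe_toReal, coe_nnnorm, Complex.norm_real, Real.norm_eq_abs] at h2
  exact (le_abs_self _).trans h2

/-- A nonzero term in the expansion of `A ^ m` is a walk whose steps follow edges or, through
diagonal entries, stay in place. -/
lemma edist_le_of_pow_apply_ne_zero {n : ℕ} {A : Matrix (Fin n) (Fin n) ℂ} (hA : A.IsHermitian)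
    (m : ℕ) (i j : Fin n) (h : (A ^ m) i j ≠ 0) : (hermitianGraph A hA).edist i j ≤ m := by
  induction m generalizing j with
  | zero =>
    have : i = j := by
      by_contra hij
      exact h (by rw [pow_zero, Matrix.one_apply_ne hij])
    simp [this]
  | succ m ih =>
    rw [pow_succ, Matrix.mul_apply] at h
    obtain ⟨k, -, hk⟩ := Finset.exists_ne_zero_of_sum_ne_zero h
    have h1 : (hermitianGraph A hA).edist k j ≤ 1 := by
      rw [SimpleGraph.edist_le_one_iff_adj_or_eq]
      by_cases hkj : k = j
      · exact Or.inr hkj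
      · exact Or.inl ⟨hkj, right_ne_zero_of_mul hk⟩
    push_cast
    exact SimpleGraph.edist_triangle.trans (add_le_add (ih k (left_ne_zero_of_mul hk)) h1)

open Polynomial in
lemma aeval_apply_eq_zero_of_natDegree_lt_edist {n : ℕ} {A : Matrix (Fin n) (Fin n) ℂ}
    (hA : A.IsHermitian) {i j : Fin n} {p : ℝ[X]}
    (hp : (p.natDegree : ℕ∞) < (hermitianGraph A hA).edist i j) : (aeval A p) i j = 0 := by
  rw [aeval_eq_sum_range, Matrix.sum_apply]
  refine Finset.sum_eq_zero fun m hm => ?_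
  rw [Matrix.smul_apply]
  have : (A ^ m) i j = 0 := by
    by_contra h
    refine absurd (hp.trans_le (edist_le_of_pow_apply_ne_zero hA m i j h)) (not_lt.2 ?_)
    exact_mod_cast Nat.lt_succ_iff.1 (Finset.mem_range.1 hm)
  rw [this, smul_zero]

/-- On the finite spectrum any `f` agrees with an interpolating polynomial, and at infinite distance
every degree is admissible. -/
lemma cfc_apply_eq_zero_of_edist_eq_top {n : ℕ} {A : Matrix (Fin n) (Fin n) ℂ}
    (hA : A.IsHermitian) {i j : Fin n} (h : (hermitianGraph A hA).edist i j = ⊤) (f : ℝ → ℝ) :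
    cfc f A i j = 0 := by
  obtain ⟨w, -, hw⟩ := hA.exists_cfc_apply_eq_sum i j
  set p := Lagrange.interpolate (Finset.univ.image hA.eigenvalues) id f with hp
  have h1 : cfc f A i j = cfc p.eval A i j := by
    rw [hw, hw]
    refine Finset.sum_congr rfl fun k _ => ?_
    rw [hp, ← Lagrange.eval_interpolate_at_node (s := Finset.univ.image hA.eigenvalues) (v := id) f
      (Set.injOn_id _) (Finset.mem_image_of_mem _ (Finset.mem_univ k))]
    rfl
  rw [h1, cfc_polynomial p A hA.isSelfAdjoint]
  exact aeval_apply_eq_zero_of_natDegree_lt_edist hA (by rw [h]; exact ENat.natCast_lt_top _)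

open Polynomial in
/-- An entry of a fractional power at distance `d`, in terms of the eigenvalues rescaled to
`[-1, 1]`. -/
lemma exists_matrixPower_apply_eq_sum {n : ℕ} {A : Matrix (Fin n) (Fin n) ℂ} (hA : A.PosSemidef)
    {i j : Fin n} {d : ℕ} (h : (hermitianGraph A hA.isHermitian).edist i j = d) :
    ∃ (w : Fin n → ℂ) (y : Fin n → ℝ), ∑ k, ‖w k‖ ≤ 1 ∧ (∀ k, |y k| ≤ 1) ∧
      (∀ p : ℝ[X], p.natDegree < d → ∑ k, w k * ((p.eval (y k) : ℝ) : ℂ) = 0) ∧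
      ∀ α : ℝ, matrixPower A α i j = (((matrixSpectralRadius A / 4) ^ α : ℝ) : ℂ) *
        ∑ k, w k * (((2 * (1 + y k)) ^ α : ℝ) : ℂ) := by
  obtain ⟨w, hw1, hw⟩ := hA.isHermitian.exists_cfc_apply_eq_sum i j
  have hev0 := hA.eigenvalues_nonneg
  have hev1 := eigenvalues_le_matrixSpectralRadius hA
  set ev := hA.isHermitian.eigenvalues
  set ρ := matrixSpectralRadius A with hρ
  have hρ0 : 0 ≤ ρ := ENNReal.toReal_nonneg
  have hy (k : Fin n) : |2 / ρ * ev k - 1| ≤ 1 := by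
    rw [abs_le, div_mul_eq_mul_div]
    refine ⟨by linarith [div_nonneg (mul_nonneg zero_le_two (hev0 k)) hρ0], ?_⟩
    have : 2 * ev k / ρ ≤ 2 := div_le_of_le_mul₀ hρ0 zero_le_two (by linarith [hev1 k])
    linarith
  refine ⟨w, fun k => 2 / ρ * ev k - 1, hw1, hy, fun p hp => ?_, fun α => ?_⟩
  · set q : ℝ[X] := p.comp (C (2 / ρ) * X - 1) with hq
    have hdeg : q.natDegree < d := by
      have h1 : (C (2 / ρ) * X - 1 : ℝ[X]).natDegree ≤ 1 := by compute_degree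
      exact (natDegree_comp_le.trans (mul_le_of_le_one_right (Nat.zero_le _) h1)).trans_lt hp
    have h1 := aeval_apply_eq_zero_of_natDegree_lt_edist hA.isHermitian (i := i) (j := j) (p := q)
      (by rw [h]; exact_mod_cast hdeg)
    rw [← cfc_polynomial q A hA.isHermitian.isSelfAdjoint, hw] at h1
    rw [← h1]
    refine Finset.sum_congr rfl fun k _ => ?_
    simp [hq]
  · rw [matrixPower, hw, Finset.mul_sum]
    refine Finset.sum_congr rfl fun k _ => ?_
    -- For `ρ = 0` all eigenvalues vanish, and division by zero gives `y = -1`, so the identity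
    -- persists.
    have : ev k = ρ / 4 * (2 * (1 + (2 / ρ * ev k - 1))) := by
      rcases hρ0.eq_or_lt with h0 | h0
      · rw [← h0]
        have := hev0 k
        have := hev1 k
        rw [← h0] at this
        simp only [zero_div, zero_mul]
        linarith
      · field_simp
        ring
    conv_lhs => rw [this, Real.mul_rpow (by positivity) (two_mul_one_add_nonneg (hy k))]
    push_cast
    ring

/-! ### Entrywise decay bounds -/

lemma norm_matrixPower_apply_le {α : ℝ} (h0 : 0 < α) (h1 : α < 1) {n : ℕ}
    {A : Matrix (Fin n) (Fin n) ℂ} (hA : A.PosSemidef) {i j : Fin n} {d : ℕ} (hd2 : 2 ≤ d)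
    (h : (hermitianGraph A hA.isHermitian).edist i j = d) :
    ‖matrixPower A α i j‖ ≤
      α / Real.Gamma (1 - α) *
        (10 * Real.exp d * matrixSpectralRadius A ^ α / ((4 : ℝ) ^ α * (d : ℝ) ^ d) *
            lowerIncompleteGamma ((d : ℝ) - α - 1) ((d : ℝ) / 2)
          + 10 * (5 * matrixSpectralRadius A / (4 * (d : ℝ) ^ 2)) ^ α *
              (upperIncompleteGamma α (4 / 5) - upperIncompleteGamma α (2 * (d : ℝ) / 5))
          + matrixSpectralRadius A ^ α / (α * (d : ℝ) ^ (2 * α))) := by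
  obtain ⟨w, y, hw, hy, hd, he⟩ := exists_matrixPower_apply_eq_sum hA h
  have hb := norm_sum_rpow_le_incompleteGamma hw hy hd h0 h1 hd2
  have hΓ : 0 < Real.Gamma (1 - α) := Real.Gamma_pos_of_pos (by linarith)
  have hρ0 : 0 ≤ matrixSpectralRadius A := ENNReal.toReal_nonneg
  set ρ := matrixSpectralRadius A
  have hdp : (0 : ℝ) < d := by positivity
  have hρα : 0 ≤ (ρ / 4) ^ α := by positivity
  rw [he, norm_mul, Complex.norm_real, Real.norm_of_nonneg hρα]
  rw [div_mul_eq_mul_div, div_le_iff₀ h0] at hb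
  have e1 : (5 * ρ / (4 * (d : ℝ) ^ 2)) ^ α = (ρ / 4) ^ α * ((d : ℝ) ^ 2 / 5) ^ (-α) := by
    rw [Real.rpow_neg (by positivity), ← Real.inv_rpow (by positivity),
      ← Real.mul_rpow (by positivity) (by positivity)]
    congr 1
    field_simp
  have e2 : ρ ^ α / (α * (d : ℝ) ^ (2 * α)) = (ρ / 4) ^ α * (((d : ℝ) ^ 2 / 4) ^ (-α) / α) := by
    rw [Real.rpow_neg (by positivity), Real.div_rpow hρ0 (by norm_num),
      Real.div_rpow (by positivity) (by norm_num), ← Real.rpow_natCast (d : ℝ) 2,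
      ← Real.rpow_mul hdp.le]
    push_cast
    field_simp
  rw [e1, e2, div_mul_eq_mul_div, le_div_iff₀ hΓ, mul_assoc, mul_comm _ (Real.Gamma _)]
  refine (mul_le_mul_of_nonneg_left hb hρα).trans_eq ?_
  rw [Real.div_rpow hρ0 (by norm_num)]
  field_simp

/-- The substitution `t = u²` turns the integrand into `2 exp (-u²)`. Only differences occur, so the
value of the full Gaussian integral is not needed. -/
lemma upperIncompleteGamma_half_sub {a b : ℝ} (ha : 0 ≤ a) (hab : a ≤ b) :
    upperIncompleteGamma (1 / 2) (a ^ 2) - upperIncompleteGamma (1 / 2) (b ^ 2) =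
      √Real.pi * (realErfc a - realErfc b) := by
  have hint (u v : ℝ) : IntervalIntegrable (fun t : ℝ => Real.exp (-t ^ 2))
      MeasureTheory.volume u v := Continuous.intervalIntegrable (by fun_prop) _ _
  have hE (z : ℝ) : ∫ t in (-z)..z, Real.exp (-t ^ 2) = 2 * ∫ t in (0 : ℝ)..z, Real.exp (-t ^ 2) := by
    have h := intervalIntegral.integral_comp_neg (a := 0) (b := z)
      (fun t : ℝ => Real.exp (-t ^ 2))
    simp only [neg_sq, neg_zero] at h
    rw [← intervalIntegral.integral_add_adjacent_intervals (hint (-z) 0) (hint 0 z), ← h]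
    ring
  have hU {c : ℝ} (hc : 0 ≤ c) : upperIncompleteGamma (1 / 2) (c ^ 2) =
      2 * ∫ t in Set.Ioi c, Real.exp (-t ^ 2) := by
    rw [upperIncompleteGamma, ← MeasureTheory.integral_comp_rpow_Ioi_of_pos' (p := 2) two_pos
      (sq_nonneg c), ← MeasureTheory.integral_const_mul]
    have : (c ^ 2) ^ ((2 : ℝ)⁻¹) = c := by
      rw [← Real.rpow_natCast, ← Real.rpow_mul hc]
      norm_num
    rw [this]
    refine MeasureTheory.setIntegral_congr_fun measurableSet_Ioi fun t ht => ?_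
    have ht0 : 0 < t := hc.trans_lt ht
    have e1 : (t ^ (2 : ℝ)) ^ ((1 : ℝ) / 2 - 1) = t⁻¹ := by
      rw [← Real.rpow_mul ht0.le, ← Real.rpow_neg_one]
      norm_num
    simp only [smul_eq_mul]
    rw [e1, Real.rpow_two, show (2 : ℝ) - 1 = 1 by norm_num, Real.rpow_one]
    field_simp
  have hI : MeasureTheory.IntegrableOn (fun t : ℝ => Real.exp (-t ^ 2)) (Set.Ioi a) := by
    have := integrable_exp_neg_mul_sq one_pos
    simp only [neg_mul, one_mul] at this
    exact this.integrableOn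
  rw [hU ha, hU (ha.trans hab), ← mul_sub, intervalIntegral.integral_Ioi_sub_Ioi hI hab, realErfc,
    realErfc, realErf, realErf, hE, hE,
    ← intervalIntegral.integral_interval_sub_left (hint 0 b) (hint 0 a)]
  have := (Real.sqrt_pos.2 Real.pi_pos).ne'
  field_simp
  ring

lemma lowerIncompleteGamma_nonneg {z s : ℝ} (hs : 0 ≤ s) : 0 ≤ lowerIncompleteGamma z s :=
  intervalIntegral.integral_nonneg hs fun _ ht =>
    mul_nonneg (Real.rpow_nonneg ht.1 _) (Real.exp_pos _).le

lemma norm_matrixSqrt_apply_le {n : ℕ} {A : Matrix (Fin n) (Fin n) ℂ} (hA : A.PosSemidef)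
    {i j : Fin n} {d : ℕ} (hd2 : 2 ≤ d)
    (h : (hermitianGraph A hA.isHermitian).edist i j = d) :
    ‖matrixSqrt A i j‖ ≤
      1 / (2 * √Real.pi) *
        (10 * Real.exp d * √(Real.pi * matrixSpectralRadius A) / (2 * (d : ℝ) ^ d) *
            lowerIncompleteGamma ((d : ℝ) - 3 / 2) ((d : ℝ) / 2)
          + 5 * √(5 * Real.pi * matrixSpectralRadius A) / (d : ℝ) *
              (realErfc (2 / √5) - realErfc √(2 * (d : ℝ) / 5))
          + 2 * √(matrixSpectralRadius A) / (d : ℝ)) := by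
  have hs : matrixSqrt A = matrixPower A (1 / 2) := by
    rw [matrixSqrt, matrixPower]
    congr 1
    exact funext Real.sqrt_eq_rpow
  have hb := norm_matrixPower_apply_le one_half_pos one_half_lt_one hA hd2 h
  have hρ0 : 0 ≤ matrixSpectralRadius A := ENNReal.toReal_nonneg
  rw [hs]
  set ρ := matrixSpectralRadius A
  have hd2' : (2 : ℝ) ≤ d := by exact_mod_cast hd2
  have hdp : (0 : ℝ) < d := by linarith
  have hpi := Real.sqrt_pos.2 Real.pi_pos
  have h5 : √(5 : ℝ) ^ 2 = 5 := Real.sq_sqrt (by norm_num)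
  have hle : 2 / √5 ≤ √(2 * (d : ℝ) / 5) := by
    refine Real.le_sqrt_of_sq_le ?_
    rw [div_pow, h5]
    linarith
  have hU := upperIncompleteGamma_half_sub (by positivity) hle
  rw [div_pow, h5, Real.sq_sqrt (by positivity), show (2 : ℝ) ^ 2 / 5 = 4 / 5 by norm_num] at hU
  have hγ : 0 ≤ lowerIncompleteGamma ((d : ℝ) - 3 / 2) ((d : ℝ) / 2) :=
    lowerIncompleteGamma_nonneg (by positivity)
  have h4 : √(4 : ℝ) = 2 := by rw [show (4 : ℝ) = 2 ^ 2 by norm_num, Real.sqrt_sq zero_le_two]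
  have e1 : √(5 * ρ / (4 * (d : ℝ) ^ 2)) = √5 * √ρ / (2 * d) := by
    rw [Real.sqrt_div (by positivity), Real.sqrt_mul (by norm_num), Real.sqrt_mul (by norm_num),
      Real.sqrt_sq hdp.le, h4]
  rw [show (1 : ℝ) - 1 / 2 = 1 / 2 by norm_num, Real.Gamma_one_half_eq, hU,
    show (d : ℝ) - 1 / 2 - 1 = d - 3 / 2 by ring, ← Real.sqrt_eq_rpow, ← Real.sqrt_eq_rpow,
    ← Real.sqrt_eq_rpow, e1, h4, show (2 : ℝ) * (1 / 2) = 1 by norm_num, Real.rpow_one] at hb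
  rw [Real.sqrt_mul Real.pi_pos.le, Real.sqrt_mul (by positivity), Real.sqrt_mul (by norm_num)]
  have h1pi : 1 ≤ √Real.pi := Real.one_le_sqrt.2 (by linarith [Real.pi_gt_three])
  refine hb.trans ?_
  rw [show (1 : ℝ) / 2 / √Real.pi = 1 / (2 * √Real.pi) by field_simp]
  -- Setting `α = 1 / 2` gives the last two terms exactly; the first is weakened from `√ρ` to
  -- `√(πρ)`, using `1 ≤ √π`.
  refine mul_le_mul_of_nonneg_left (add_le_add (add_le_add ?_ (le_of_eq ?_)) (le_of_eq ?_))
    (by positivity)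
  · gcongr
    exact le_mul_of_one_le_left (Real.sqrt_nonneg _) h1pi
  · field_simp
    ring
  · field_simp

lemma norm_matrixPower_apply_le_power_law {α : ℝ} (h0 : 0 < α) (h1 : α < 1) {n : ℕ}
    {A : Matrix (Fin n) (Fin n) ℂ} (hA : A.PosSemidef) {i j : Fin n} {d : ℕ} (hd2 : 2 ≤ d)
    (h : (hermitianGraph A hA.isHermitian).edist i j = d) :
    ‖matrixPower A α i j‖ ≤ α / Real.Gamma (1 - α) * (100 / (1 - α) + 1 / α) *
      matrixSpectralRadius A ^ α * (d : ℝ) ^ (-(2 * α)) := by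
  obtain ⟨w, y, hw, hy, hd, he⟩ := exists_matrixPower_apply_eq_sum hA h
  have hb := norm_sum_rpow_le_power_law hw hy hd h0 h1 hd2
  have hΓ : 0 < Real.Gamma (1 - α) := Real.Gamma_pos_of_pos (by linarith)
  have hρ0 : 0 ≤ matrixSpectralRadius A := ENNReal.toReal_nonneg
  have hdp : (0 : ℝ) < d := by positivity
  have h1α : 0 < 1 - α := by linarith
  rw [← Real.rpow_natCast (d : ℝ) 2, ← Real.rpow_mul hdp.le, ← neg_mul_eq_mul_neg,
    Nat.cast_ofNat] at hb
  rw [he, norm_mul, Complex.norm_real, Real.norm_of_nonneg (by positivity)]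
  have h3 : ‖∑ k, w k * (((2 * (1 + y k)) ^ α : ℝ) : ℂ)‖ ≤
      α / Real.Gamma (1 - α) * ((100 / (1 - α) + 1 / α) * (d : ℝ) ^ (-(2 * α))) := by
    rw [← inv_div (Real.Gamma _), ← div_eq_inv_mul, le_div_iff₀' (by positivity)]
    exact hb
  have h4 : (matrixSpectralRadius A / 4) ^ α ≤ matrixSpectralRadius A ^ α := by
    gcongr
    linarith
  refine (mul_le_mul h4 h3 (norm_nonneg _) (by positivity)).trans_eq ?_
  ring

theorem theorem3p3 :
    -- the bound for all exponents in `(0, 1)`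
    (∀ α : ℝ, 0 < α → α < 1 →
      ∀ (n : ℕ) (A : Matrix (Fin n) (Fin n) ℂ) (hA : A.PosSemidef) (i j : Fin n),
        ((hermitianGraph A hA.isHermitian).edist i j = ⊤ → matrixPower A α i j = 0) ∧
        ∀ d : ℕ, 2 ≤ d → (hermitianGraph A hA.isHermitian).edist i j = d →
          ‖matrixPower A α i j‖ ≤
            α / Real.Gamma (1 - α) *
              (10 * Real.exp d * matrixSpectralRadius A ^ α / ((4 : ℝ) ^ α * (d : ℝ) ^ d) *
                  lowerIncompleteGamma ((d : ℝ) - α - 1) ((d : ℝ) / 2)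
                + 10 * (5 * matrixSpectralRadius A / (4 * (d : ℝ) ^ 2)) ^ α *
                    (upperIncompleteGamma α (4 / 5) - upperIncompleteGamma α (2 * (d : ℝ) / 5))
                + matrixSpectralRadius A ^ α / (α * (d : ℝ) ^ (2 * α)))) ∧
    -- the form for the square root
    (∀ (n : ℕ) (A : Matrix (Fin n) (Fin n) ℂ) (hA : A.PosSemidef) (i j : Fin n),
        ((hermitianGraph A hA.isHermitian).edist i j = ⊤ → matrixSqrt A i j = 0) ∧
        ∀ d : ℕ, 2 ≤ d → (hermitianGraph A hA.isHermitian).edist i j = d →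
          ‖matrixSqrt A i j‖ ≤
            1 / (2 * √Real.pi) *
              (10 * Real.exp d * √(Real.pi * matrixSpectralRadius A) / (2 * (d : ℝ) ^ d) *
                  lowerIncompleteGamma ((d : ℝ) - 3 / 2) ((d : ℝ) / 2)
                + 5 * √(5 * Real.pi * matrixSpectralRadius A) / (d : ℝ) *
                    (realErfc (2 / √5) - realErfc √(2 * (d : ℝ) / 5))
                + 2 * √(matrixSpectralRadius A) / (d : ℝ))) ∧
    -- power-law decay of order `d ^ (-2 α)`, with a constant that depends on `α` only
    (∀ α : ℝ, 0 < α → α < 1 →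
      ∃ C : ℝ, 0 < C ∧
        ∀ (n : ℕ) (A : Matrix (Fin n) (Fin n) ℂ) (hA : A.PosSemidef) (i j : Fin n) (d : ℕ),
          2 ≤ d → (hermitianGraph A hA.isHermitian).edist i j = d →
            ‖matrixPower A α i j‖ ≤ C * matrixSpectralRadius A ^ α * (d : ℝ) ^ (-(2 * α))) := by
  exact ⟨fun α h0 h1 n A hA i j => ⟨fun h => cfc_apply_eq_zero_of_edist_eq_top hA.isHermitian h _,
      fun d hd h => norm_matrixPower_apply_le h0 h1 hA hd h⟩,
    fun n A hA i j => ⟨fun h => cfc_apply_eq_zero_of_edist_eq_top hA.isHermitian h _,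
      fun d hd h => norm_matrixSqrt_apply_le hA hd h⟩,
    fun α h0 h1 => ⟨α / Real.Gamma (1 - α) * (100 / (1 - α) + 1 / α), by
      have := Real.Gamma_pos_of_pos (sub_pos.2 h1)
      have := sub_pos.2 h1
      positivity, fun n A hA i j d hd h => norm_matrixPower_apply_le_power_law h0 h1 hA hd h⟩⟩
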